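/- **Setting.** Let $d\ge 1$. An instance of $d$-hypercube bin packing is a finite list $L$ of items, each item being a $d$-dimensional hypercube of side length in $(0,1]$; a bin is a unit $d$-hypercube. A packing of $L$ assigns to every item a bin and an axis-parallel position inside that bin so that the interiors of items in the same bin are disjoint; its size is the number of bins used, and $\mathrm{OPT}(L)$ is the minimum size of a packing of $L$. A (deterministic) online bounded-space algorithm $\mathcal A$ receives the items one at a time and places each of them irrevocably, knowing only the items that have arrived so far, either in a bin that is currently open or in a new empty bin; a new bin is open until the algorithm closes it, a closed bin never receives further items, and the number of bins open at any time is at most a constant $M$ that does not depend on the instance. Let $\mathcal A(L)$ be the number of bins that $\mathcal A$ uses on $L$. The asymptotic performance ratio of $\mathcal A$ is $$\mathcal R^\infty_{\mathcal A}=\limsup_{n\to\infty}\ \sup_L\Bigl\{\frac{\mathcal A(L)}{\mathrm{OPT}(L)}:\mathrm{OPT}(L)=n\Bigr\}\in[0,\infty],$$ and the optimal asymptotic performance ratio $\rho_d$ is the infimum of $\mathcal R^\infty_{\mathcal A}$ over all online bounded-space algorithms $\mathcal A$ in dimension $d$. **Theorem.** There is an absolute constant $d_0$ such that, for every $d\ge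 d_0$, every online bounded-space algorithm $\mathcal A$ for $d$-dimensional hypercube bin packing satisfies $$\mathcal R^\infty_{\mathcal A}\ \ge\ \frac{d}{10\log d},$$ and hence $\rho_d\ge d/(10\log d)$, where $\log$ is the natural logarithm. In particular $\rho_d$ is not $O(\log d)$ as $d\to\infty$, so the conjecture of Epstein and van Stee that $\rho_d=\Theta(\log d)$ is false. -/

import Mathlib

namespace HypercubePacking

/-- An item is a `d`-hypercube of side length `s` with `0 < s ≤ 1`; it is given by `s`. -/
abbrev Item : Type := Set.Ioc (0 : ℝ) 1

/-- Where an item is put: the (label of the) bin, and the lower corner of the item, in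
coordinates in which every bin is the unit cube `[0,1]^d`. -/
structure Placement (d : ℕ) where
  bin : ℕ
  corner : Fin d → ℝ

/-- The open axis-parallel hypercube of side length `s` with lower corner `x`. -/
def openCube {d : ℕ} (x : Fin d → ℝ) (s : ℝ) : Set (Fin d → ℝ) :=
  {y | ∀ j, x j < y j ∧ y j < x j + s}

/-- A packing of the list `L` into unit bins: every item lies in its bin, and different items in
the same bin do not overlap (their interiors are disjoint). -/
def IsPacking {d : ℕ} (L : List Item) (P : Fin L.length → Placement d) : Prop :=
  (∀ i j, 0 ≤ (P i).corner j ∧ (P i).corner j + (L.get i : ℝ) ≤ 1) ∧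
  ∀ i i', i ≠ i' → (P i).bin = (P i').bin →
    Disjoint (openCube (P i).corner (L.get i)) (openCube (P i').corner (L.get i'))

/-- The size of a packing: the number of used bins. -/
def packingSize {d n : ℕ} (P : Fin n → Placement d) : ℕ :=
  (Finset.univ.image fun i => (P i).bin).card

/-- `OPT(L)`: the minimum size of a packing of `L` into `d`-dimensional unit bins. -/
noncomputable def opt (d : ℕ) (L : List Item) : ℕ :=
  sInf {m | ∃ P : Fin L.length → Placement d, IsPacking L P ∧ packingSize P = m}

/-- The placements that the items of `L`, arriving one after the other, receive from an online
rule `f`. Here `f H x` is the placement of the item `x` that arrives after the items of `H`. -/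
def run {d : ℕ} (f : List Item → Item → Placement d) (L : List Item) :
    Fin L.length → Placement d :=
  fun i => f (L.take i) (L.get i)

/-- A (deterministic) algorithm for online bounded space `d`-hypercube bin packing. An arriving
item is placed irrevocably, with knowledge of the earlier items only, in a bin that is currently
open or in a new empty bin. A closed bin stays closed, and the number of open bins is bounded by
a constant that does not depend on the instance. -/
structure OnlineBoundedSpaceAlgorithm (d : ℕ) where
  /-- `place H x` is the placement of the item `x` arriving after the items of `H`. -/
  place : List Item → Item → Placement d
  /-- `openBins H` is the set of bins that are open once the items of `H` have been packed. -/
  openBins : List Item → Finset ℕ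
  /-- The bound on the number of open bins. -/
  maxOpen : ℕ
  isPacking_run : ∀ L, IsPacking L (run place L)
  openBins_nil : openBins [] = ∅
  openBins_append : ∀ H x, openBins (H ++ [x]) ⊆ insert (place H x).bin (openBins H)
  bin_open_or_new : ∀ H x, (place H x).bin ∈ openBins H ∨
    ∀ i, (run place H i).bin ≠ (place H x).bin
  card_openBins_le : ∀ H, (openBins H).card ≤ maxOpen

/-- `A(L)`: the number of bins that `A` uses for the list `L`. -/
def OnlineBoundedSpaceAlgorithm.cost {d : ℕ} (A : OnlineBoundedSpaceAlgorithm d)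
    (L : List Item) : ℕ :=
  packingSize (run A.place L)

/-- The asymptotic performance ratio of `A`, that is,
`limsup_{n → ∞} sup {A(L) / OPT(L) : OPT(L) = n}`, as an element of `[0, ∞]`. -/
noncomputable def OnlineBoundedSpaceAlgorithm.asymptoticRatio {d : ℕ}
    (A : OnlineBoundedSpaceAlgorithm d) : ENNReal :=
  Filter.limsup
    (fun n : ℕ => ⨆ (L : List Item) (_ : opt d L = n), (A.cost L : ENNReal) / (opt d L : ENNReal))
    Filter.atTop

/-- The optimal asymptotic performance ratio of online bounded space `d`-hypercube bin packing:
the infimum of the asymptotic performance ratios of its algorithms. -/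
noncomputable def optimalAsymptoticRatio (d : ℕ) : ENNReal :=
  ⨅ A : OnlineBoundedSpaceAlgorithm d, A.asymptoticRatio

end HypercubePacking

/-! Cubes of class `m` have side slightly above `1 / (m + 1)`, so a bin holds at most `m ^ d` of
them. If the classes `1, …, K` arrive one after another, bounded space lets each phase reuse only
`maxOpen` earlier bins (`cost_append_ge`). A layout of one bin with `c m` cubes of class `m`,
repeated in `B` bins, thus costs the algorithm about `B * ∑ c m / m ^ d`, while the optimum is `B`.

It remains to fit nearly `m ^ d` cubes of every class into the same bin. Each class uses its own
grid, indexed by words, and at the coordinates marked for it the last interval is pushed to the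
upper end of `[0, 1]`. Cubes of classes `k < m` are then separated at any coordinate marked for `m`
but not `k` where the word of class `m` has its last letter (`disjoint_wordCorner_of_lt`). Marks
given by linear forms over `𝔽₂` provide at least `d / 8` candidate coordinates per pair
(`exists_marks`), so only a fraction of at most `K * exp (-d / (8 * K))` of the words is lost
(`card_code_ge`). Taking `K` about `d / (9 * log d)` makes this loss negligible and the total weight
nearly `K`. -/

open Finset Filter Topology

namespace HypercubePacking

/-! ### Packings and the number of large items per bin -/

/-- A cube of side more than `1 / (m + 1)` in the unit cube has an interior point all of whose
coordinates are multiples of `1 / (m + 1)`. -/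
lemma exists_grid_point {d m : ℕ} {x : Fin d → ℝ} {s : ℝ} (hs : 1 / ((m : ℝ) + 1) < s)
    (h0 : ∀ j, 0 ≤ x j) (h1 : ∀ j, x j + s ≤ 1) :
    ∃ a : Fin d → Fin m, (fun j => ((a j : ℝ) + 1) / ((m : ℝ) + 1)) ∈ openCube x s := by
  have hm : (0 : ℝ) < (m : ℝ) + 1 := by positivity
  have hs' : 1 < s * ((m : ℝ) + 1) := by rwa [div_lt_iff₀ hm] at hs
  -- In each coordinate the first multiple of `1 / (m + 1)` strictly above `x j` is taken; letter
  -- `a` stands for the multiple `a + 1`.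
  have key : ∀ j, ⌊x j * ((m : ℝ) + 1)⌋₊ < m := by
    intro j
    rw [Nat.floor_lt (mul_nonneg (h0 j) hm.le)]
    nlinarith [mul_le_mul_of_nonneg_right (h1 j) hm.le]
  refine ⟨fun j => ⟨_, key j⟩, fun j => ⟨?_, ?_⟩⟩
  · rw [lt_div_iff₀ hm]
    exact Nat.lt_floor_add_one _
  · rw [div_lt_iff₀ hm, add_mul]
    have := Nat.floor_le (mul_nonneg (h0 j) hm.le)
    simp only
    linarith

/-- A unit bin has room for at most `m ^ d` items of side more than `1 / (m + 1)`. -/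
lemma IsPacking.card_le_mul_card_image {d m : ℕ} {L : List Item}
    {P : Fin L.length → Placement d} (hP : IsPacking L P) (S : Finset (Fin L.length))
    (hS : ∀ i ∈ S, 1 / ((m : ℝ) + 1) < L.get i) :
    S.card ≤ m ^ d * (S.image fun i => (P i).bin).card := by
  refine Finset.card_le_mul_card_image (f := fun i => (P i).bin) S _ fun b _ => ?_
  calc (S.filter fun i => (P i).bin = b).card
      ≤ (univ : Finset (Fin d → Fin m)).card := by
        refine card_le_card_of_forall_subsingleton
          (fun i a => (fun j => ((a j : ℝ) + 1) / ((m : ℝ) + 1)) ∈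
            openCube (P i).corner (L.get i)) (fun i hi => ?_) fun a _ i hi i' hi' => ?_
        · obtain ⟨a, ha⟩ := exists_grid_point (hS i (mem_filter.1 hi).1)
            (fun j => (hP.1 i j).1) fun j => (hP.1 i j).2
          exact ⟨a, mem_univ _, ha⟩
        · by_contra hne
          exact Set.disjoint_left.1 (hP.2 i i' hne
            ((mem_filter.1 hi.1).2.trans (mem_filter.1 hi'.1).2.symm)) hi.2 hi'.2
    _ = m ^ d := by simp

/-- Any list of items, packed by any valid packing, uses at least `opt` bins. -/
lemma IsPacking.opt_le {d : ℕ} {L : List Item} {P : Fin L.length → Placement d}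
    (hP : IsPacking L P) : opt d L ≤ packingSize P :=
  Nat.sInf_le ⟨P, hP, rfl⟩

/-- A packing of items of pairwise different slots of a layout in which different slots do not
overlap. -/
lemma isPacking_of_slots {d : ℕ} {ι : Type*} (l : List ι) (hl : l.Nodup) (size : ι → Item)
    (pl : ι → Placement d)
    (hin : ∀ a ∈ l, ∀ j, 0 ≤ (pl a).corner j ∧ (pl a).corner j + (size a : ℝ) ≤ 1)
    (hdis : ∀ a ∈ l, ∀ b ∈ l, a ≠ b → (pl a).bin = (pl b).bin →
      Disjoint (openCube (pl a).corner (size a)) (openCube (pl b).corner (size b))) :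
    IsPacking (l.map size) fun i => pl (l.get (i.cast (List.length_map _))) := by
  refine ⟨fun i j => ?_, fun i i' hne hbin => ?_⟩
  · simpa using hin (l.get (i.cast (List.length_map _))) (List.get_mem _ _) j
  · have := hdis (l.get (i.cast (List.length_map _))) (List.get_mem _ _)
      (l.get (i'.cast (List.length_map _))) (List.get_mem _ _)
      (fun h => hne (by simpa [Fin.ext_iff] using (List.nodup_iff_injective_get.1 hl) h)) hbin
    simpa using this

/-! ### The number of bins opened while equal items arrive -/

namespace OnlineBoundedSpaceAlgorithm

variable {d : ℕ} (A : OnlineBoundedSpaceAlgorithm d)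

/-- The bins that `A` uses for the items of `L` from the `n`-th one on. -/
def binsFrom (n : ℕ) (L : List Item) : Finset ℕ :=
  (univ.filter fun i : Fin L.length => n ≤ i).image fun i => (run A.place L i).bin

lemma mem_binsFrom {n : ℕ} {L : List Item} {b : ℕ} :
    b ∈ A.binsFrom n L ↔
      ∃ (i : ℕ) (h : i < L.length), n ≤ i ∧ (A.place (L.take i) L[i]).bin = b := by
  simp only [binsFrom, mem_image, mem_filter, mem_univ, true_and, run]
  constructor
  · rintro ⟨i, hi, h⟩
    exact ⟨i, i.2, hi, h⟩
  · rintro ⟨i, h, hi, hb⟩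
    exact ⟨⟨i, h⟩, hi, hb⟩

lemma card_binsFrom_zero (L : List Item) : (A.binsFrom 0 L).card = A.cost L := by
  simp [binsFrom, cost, packingSize]

lemma binsFrom_zero_append (H T : List Item) :
    A.binsFrom 0 (H ++ T) = A.binsFrom 0 H ∪ A.binsFrom H.length (H ++ T) := by
  ext b
  simp only [mem_union, mem_binsFrom, Nat.zero_le, true_and]
  constructor
  · rintro ⟨i, h, hb⟩
    rcases lt_or_ge i H.length with hi | hi
    · rw [List.getElem_append_left hi, List.take_append_of_le_length hi.le] at hb
      exact Or.inl ⟨i, hi, hb⟩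
    · exact Or.inr ⟨i, h, hi, hb⟩
  · rintro (⟨i, hi, hb⟩ | ⟨i, h, -, hb⟩)
    · refine ⟨i, by simp; omega, ?_⟩
      rwa [List.getElem_append_left hi, List.take_append_of_le_length hi.le]
    · exact ⟨i, h, hb⟩

lemma bin_mem_openBins_of_mem {H : List Item} {x : Item}
    (h : (A.place H x).bin ∈ A.binsFrom 0 H) : (A.place H x).bin ∈ A.openBins H := by
  refine (A.bin_open_or_new H x).resolve_right fun hnew => ?_
  simp only [binsFrom, mem_image] at h
  obtain ⟨i, -, hi⟩ := h
  exact hnew i hi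

/-- A bin used so far that is open at a later time is open now. -/
lemma mem_openBins_of_append {H : List Item} {b : ℕ} (hb : b ∈ A.binsFrom 0 H) (T : List Item) :
    b ∈ A.openBins (H ++ T) → b ∈ A.openBins H := by
  induction T using List.reverseRecOn with
  | nil => simp
  | append_singleton T x ih =>
    intro h
    rw [← List.append_assoc] at h
    -- If `b` is the bin that receives `x`, it is not new, since it was already used in `H`; so it
    -- was open before `x` arrived.
    rcases mem_insert.1 (A.openBins_append _ _ h) with rfl | h
    · refine ih (A.bin_mem_openBins_of_mem ?_)
      rw [binsFrom_zero_append]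
      exact mem_union_left _ hb
    · exact ih h

/-- A bin used so far that receives a later item is open now. -/
lemma inter_binsFrom_subset (H T : List Item) :
    A.binsFrom 0 H ∩ A.binsFrom H.length (H ++ T) ⊆ A.openBins H := by
  intro b hb
  obtain ⟨hb, hb'⟩ := mem_inter.1 hb
  obtain ⟨i, h, hi, rfl⟩ := A.mem_binsFrom.1 hb'
  obtain ⟨k, rfl⟩ := Nat.exists_eq_add_of_le hi
  have htake : (H ++ T).take (H.length + k) = H ++ T.take k := List.take_length_add_append _
  rw [htake] at hb ⊢
  refine A.mem_openBins_of_append hb (T.take k) (A.bin_mem_openBins_of_mem ?_)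
  rw [binsFrom_zero_append]
  exact mem_union_left _ hb

/-- This is where bounded space enters: a bin counted on both sides of the cut must be open after
`H`, and there are at most `maxOpen` of those. -/
lemma cost_add_card_binsFrom_le (H T : List Item) :
    A.cost H + (A.binsFrom H.length (H ++ T)).card ≤ A.cost (H ++ T) + A.maxOpen := by
  rw [← card_binsFrom_zero, ← card_binsFrom_zero, binsFrom_zero_append, ← card_union_add_card_inter]
  gcongr
  exact (card_le_card (A.inter_binsFrom_subset H T)).trans (A.card_openBins_le H)

lemma card_filter_le_val {n N : ℕ} :
    (univ.filter fun i : Fin N => n ≤ i).card = N - n := by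
  have h : (univ.filter fun i : Fin N => n ≤ i) = (univ.filter fun i : Fin N => i.val < n)ᶜ := by
    ext i
    simp
  rw [h, card_compl, Fin.card_filter_val_lt, Fintype.card_fin]
  omega

/-- While `t` items of side more than `1 / (m + 1)` arrive, `A` opens at least
`t / m ^ d - maxOpen` new bins. -/
lemma cost_append_ge {m : ℕ} (hm : 0 < m) (H T : List Item)
    (hT : ∀ x ∈ T, 1 / ((m : ℝ) + 1) < x) :
    (A.cost H : ℝ) + T.length / (m : ℝ) ^ d - A.maxOpen ≤ A.cost (H ++ T) := by
  have h1 := A.cost_add_card_binsFrom_le H T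
  have h2 := (A.isPacking_run (H ++ T)).card_le_mul_card_image (m := m)
    (univ.filter fun i => H.length ≤ i) (by
      rintro ⟨i, hi⟩ h
      refine hT _ ?_
      have h' : H.length ≤ i := by simpa using h
      simp [List.getElem_append_right h'])
  have hlen : (H ++ T).length - H.length = T.length := by simp
  rw [card_filter_le_val, hlen] at h2
  have h3 : (T.length : ℝ) / (m : ℝ) ^ d ≤ (A.binsFrom H.length (H ++ T)).card := by
    rw [div_le_iff₀' (by positivity)]
    exact_mod_cast h2
  have h4 : (A.cost H : ℝ) + (A.binsFrom H.length (H ++ T)).card ≤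
    A.cost (H ++ T) + A.maxOpen := by exact_mod_cast h1
  linarith

end OnlineBoundedSpaceAlgorithm

/-! ### The item sides -/

/-- The side of the items of class `m`, slightly more than `1 / (m + 1)`. -/
noncomputable def side (m : ℕ) : ℝ :=
  1 / ((m : ℝ) + 1) + 1 / (((m : ℝ) + 1) * ((m : ℝ) + 2) * ((m : ℝ) + 3))

lemma one_div_lt_side (m : ℕ) : 1 / ((m : ℝ) + 1) < side m := by
  unfold side
  have : 0 < 1 / (((m : ℝ) + 1) * ((m : ℝ) + 2) * ((m : ℝ) + 3)) := by positivity
  linarith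

lemma side_pos (m : ℕ) : 0 < side m :=
  lt_trans (by positivity) (one_div_lt_side m)

/-- Without the excess terms the slack is `1 / ((m + 1) * (m + 2))`; the cubic denominator in `side`
keeps `m + 1` excesses below it. -/
lemma side_succ_le (m : ℕ) : m * side m + side (m + 1) ≤ 1 := by
  unfold side
  push_cast
  rw [← sub_nonneg]
  have : 1 - (m * (1 / ((m : ℝ) + 1) + 1 / (((m : ℝ) + 1) * ((m : ℝ) + 2) * ((m : ℝ) + 3))) +
      (1 / ((m : ℝ) + 1 + 1) +
        1 / (((m : ℝ) + 1 + 1) * ((m : ℝ) + 1 + 2) * ((m : ℝ) + 1 + 3)))) =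
      (2 * m + 11 : ℝ) / (((m : ℝ) + 1) * ((m : ℝ) + 2) * ((m : ℝ) + 3) * ((m : ℝ) + 4)) := by
    field_simp
    ring
  rw [this]
  positivity

lemma side_antitone : Antitone side := by
  intro a b h
  unfold side
  gcongr

lemma mul_side_add_side_le {m n : ℕ} (h : m < n) : m * side m + side n ≤ 1 :=
  (by gcongr; exact side_antitone h : m * side m + side n ≤ m * side m + side (m + 1)).trans
    (side_succ_le m)

lemma mul_side_le (m : ℕ) : m * side m ≤ 1 := by
  linarith [side_succ_le m, side_pos (m + 1)]

lemma side_le_one {m : ℕ} (hm : 0 < m) : side m ≤ 1 := by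
  have h : (1 : ℝ) ≤ m := by exact_mod_cast hm
  nlinarith [mul_side_le m, side_pos m]

/-- The item of class `m`. -/
noncomputable def classItem (m : ℕ) : Item :=
  -- Since `side 0 > 1`, class `0` gets a dummy value; slots only have positive classes.
  if hm : 0 < m then ⟨side m, side_pos m, side_le_one hm⟩ else ⟨1, one_pos, le_rfl⟩

lemma coe_classItem {m : ℕ} (hm : 0 < m) : (classItem m : ℝ) = side m := by
  simp [classItem, hm]

/-! ### Intervals -/

/-- The lower end of the interval of class `m` with number `a < m`. The last interval
is moved to the upper end of `[0, 1]` when `r` holds. -/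
noncomputable def lowerEnd (m : ℕ) (r : Prop) (a : ℕ) : ℝ :=
  open Classical in if r ∧ a + 1 = m then 1 - side m else a * side m

lemma mul_side_le_lowerEnd (m : ℕ) (r : Prop) (a : ℕ) : a * side m ≤ lowerEnd m r a := by
  unfold lowerEnd
  split_ifs with h
  · have := mul_side_le m
    rw [← h.2] at this ⊢
    push_cast at this
    linarith
  · exact le_rfl

lemma lowerEnd_nonneg (m : ℕ) (r : Prop) (a : ℕ) : 0 ≤ lowerEnd m r a :=
  (mul_nonneg a.cast_nonneg (side_pos m).le).trans (mul_side_le_lowerEnd m r a)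

lemma lowerEnd_of_not {m : ℕ} {r : Prop} (hr : ¬ r) (a : ℕ) : lowerEnd m r a = a * side m := by
  simp [lowerEnd, hr]

lemma lowerEnd_last {m : ℕ} {r : Prop} (hr : r) {a : ℕ} (ha : a + 1 = m) :
    lowerEnd m r a = 1 - side m := by
  simp [lowerEnd, hr, ha]

lemma succ_mul_side_le {m a : ℕ} (h : a < m) : (a : ℝ) * side m + side m ≤ m * side m := by
  have : ((a : ℝ) + 1) * side m ≤ m * side m := by
    gcongr
    · exact (side_pos m).le
    · exact_mod_cast h
  linarith

lemma lowerEnd_add_side_le_one {m a : ℕ} (r : Prop) (h : a < m) :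
    lowerEnd m r a + side m ≤ 1 := by
  unfold lowerEnd
  split_ifs
  · linarith
  · linarith [succ_mul_side_le h, mul_side_le m]

lemma lowerEnd_add_side_le {m a b : ℕ} (r : Prop) (h : a < b) (hb : b < m) :
    lowerEnd m r a + side m ≤ lowerEnd m r b := by
  have h1 : lowerEnd m r a = a * side m := by
    unfold lowerEnd
    rw [if_neg]
    omega
  rw [h1]
  refine le_trans ?_ (mul_side_le_lowerEnd m r b)
  have : ((a : ℝ) + 1) * side m ≤ b * side m := by
    gcongr
    · exact (side_pos m).le
    · exact_mod_cast h
  linarith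

lemma disjoint_openCube {d : ℕ} {x y : Fin d → ℝ} {s t : ℝ} {j : Fin d} (h : x j + s ≤ y j) :
    Disjoint (openCube x s) (openCube y t) :=
  Set.disjoint_left.2 fun z hx hy => by linarith [(hx j).2, (hy j).1]

/-! ### Codes -/

/-- The words of class `m` such that, for every smaller class `k`, the last letter occurs
at a coordinate that is marked for `m` but not for `k`. -/
noncomputable def code {d : ℕ} (τ : ℕ → Fin d → Prop) (m : ℕ) : Finset (Fin d → ℕ) :=
  open Classical in
  (Fintype.piFinset fun _ => range m).filter fun w =>
    ∀ k, 0 < k → k < m → ∃ j, ¬ τ k j ∧ τ m j ∧ w j + 1 = m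

lemma mem_code {d : ℕ} {τ : ℕ → Fin d → Prop} {m : ℕ} {w : Fin d → ℕ} :
    w ∈ code τ m ↔
      (∀ j, w j < m) ∧ ∀ k, 0 < k → k < m → ∃ j, ¬ τ k j ∧ τ m j ∧ w j + 1 = m := by
  simp only [code, mem_filter, Fintype.mem_piFinset, mem_range]

lemma code_one {d : ℕ} (τ : ℕ → Fin d → Prop) : (code τ 1).card = 1 := by
  have : code τ 1 = Fintype.piFinset fun _ => range 1 := by
    ext w
    rw [mem_code]
    simp only [Fintype.mem_piFinset, mem_range, and_iff_left_iff_imp]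
    omega
  simp [this]

/-- The lower corner of the cube of class `m` given by the word `w`. -/
noncomputable def wordCorner {d : ℕ} (τ : ℕ → Fin d → Prop) (m : ℕ) (w : Fin d → ℕ) :
    Fin d → ℝ :=
  fun j => lowerEnd m (τ m j) (w j)

lemma disjoint_wordCorner {d : ℕ} {τ : ℕ → Fin d → Prop} {m : ℕ} {w w' : Fin d → ℕ}
    (hw : w ∈ code τ m) (hw' : w' ∈ code τ m) (h : w ≠ w') :
    Disjoint (openCube (wordCorner τ m w) (side m)) (openCube (wordCorner τ m w') (side m)) := by
  obtain ⟨j, hj⟩ := Function.ne_iff.1 h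
  rcases lt_or_gt_of_ne hj with hj | hj
  · exact disjoint_openCube (j := j) (lowerEnd_add_side_le _ hj ((mem_code.1 hw').1 j))
  · exact (disjoint_openCube (j := j) (lowerEnd_add_side_le _ hj ((mem_code.1 hw).1 j))).symm

/-- At the separating coordinate the class `k` intervals are unshifted and end by `k * side k`,
while the class `m` interval starts at `1 - side m`. -/
lemma disjoint_wordCorner_of_lt {d : ℕ} {τ : ℕ → Fin d → Prop} {k m : ℕ} {w w' : Fin d → ℕ}
    (hk : 0 < k) (hkm : k < m) (hw : w ∈ code τ k) (hw' : w' ∈ code τ m) :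
    Disjoint (openCube (wordCorner τ k w) (side k)) (openCube (wordCorner τ m w') (side m)) := by
  obtain ⟨j, hj, hj', hlast⟩ := (mem_code.1 hw').2 k hk hkm
  refine disjoint_openCube (j := j) ?_
  rw [wordCorner, wordCorner, lowerEnd_of_not hj, lowerEnd_last hj' hlast]
  linarith [succ_mul_side_le ((mem_code.1 hw).1 j), mul_side_add_side_le hkm]

/-! ### The instance -/

/-- The slots, one for each item: a class, a code word, and a bin. -/
noncomputable def slots {d : ℕ} (τ : ℕ → Fin d → Prop) (B : ℕ) :
    ℕ → List (ℕ × (Fin d → ℕ) × ℕ)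
  | 0 => []
  | K + 1 => slots τ B K ++ (code τ (K + 1) ×ˢ range B).toList.map fun p => (K + 1, p)

lemma mem_slots {d : ℕ} {τ : ℕ → Fin d → Prop} {B K : ℕ} {p : ℕ × (Fin d → ℕ) × ℕ} :
    p ∈ slots τ B K ↔ 0 < p.1 ∧ p.1 ≤ K ∧ p.2.1 ∈ code τ p.1 ∧ p.2.2 < B := by
  induction K with
  | zero => simp [slots]; omega
  | succ K ih =>
    obtain ⟨m, w, b⟩ := p
    simp only [slots, List.mem_append, ih, List.mem_map, mem_toList, mem_product, mem_range,
      Prod.mk.injEq, Prod.exists]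
    constructor
    · rintro (h | ⟨w', b', h, rfl, rfl, rfl⟩)
      · exact ⟨h.1, by omega, h.2.2⟩
      · exact ⟨by omega, le_rfl, h⟩
    · rintro ⟨h0, hK, h⟩
      rcases Nat.le_succ_iff.1 hK with hK | rfl
      · exact Or.inl ⟨h0, hK, h⟩
      · exact Or.inr ⟨w, b, h, rfl, rfl, rfl⟩

lemma nodup_slots {d : ℕ} (τ : ℕ → Fin d → Prop) (B K : ℕ) : (slots τ B K).Nodup := by
  induction K with
  | zero => simp [slots]
  | succ K ih =>
    rw [slots, List.nodup_append]
    refine ⟨ih, (nodup_toList _).map (Prod.mk_right_injective _), ?_⟩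
    rintro p hp q hq rfl
    have := (mem_slots.1 hp).2.1
    obtain ⟨q, -, rfl⟩ := List.mem_map.1 hq
    simp at this

/-- The list of items that has `B` items of class `m` for each word of the `m`-th code,
`m = 1, …, K`. -/
noncomputable def hardList {d : ℕ} (τ : ℕ → Fin d → Prop) (B K : ℕ) : List Item :=
  (slots τ B K).map fun p => classItem p.1

lemma hardList_succ {d : ℕ} (τ : ℕ → Fin d → Prop) (B K : ℕ) :
    hardList τ B (K + 1) =
      hardList τ B K ++ List.replicate ((code τ (K + 1)).card * B) (classItem (K + 1)) := by
  simp [hardList, slots, Function.comp_def]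

lemma exists_isPacking_hardList {d : ℕ} (τ : ℕ → Fin d → Prop) (B K : ℕ) :
    ∃ P : Fin (hardList τ B K).length → Placement d,
      IsPacking (hardList τ B K) P ∧ packingSize P ≤ B := by
  have hP := isPacking_of_slots (slots τ B K) (nodup_slots τ B K) (fun p => classItem p.1)
    (fun p => ⟨p.2.2, wordCorner τ p.1 p.2.1⟩) (by
      intro p hp j
      obtain ⟨h0, -, hw, -⟩ := mem_slots.1 hp
      rw [coe_classItem h0]
      exact ⟨lowerEnd_nonneg _ _ _, lowerEnd_add_side_le_one _ ((mem_code.1 hw).1 j)⟩) (by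
      rintro ⟨m, w, b⟩ hp ⟨m', w', b'⟩ hq hne hb
      obtain ⟨h0, -, hw, -⟩ := mem_slots.1 hp
      obtain ⟨h0', -, hw', -⟩ := mem_slots.1 hq
      simp only at h0 h0' hw hw' hb ⊢
      subst hb
      rw [coe_classItem h0, coe_classItem h0']
      rcases lt_trichotomy m m' with h | rfl | h
      · exact disjoint_wordCorner_of_lt h0 h hw hw'
      · exact disjoint_wordCorner hw hw' fun h => hne (by rw [h])
      · exact (disjoint_wordCorner_of_lt h0' h hw' hw).symm)
  refine ⟨_, hP, ?_⟩
  refine (card_le_card (t := range B) ?_).trans (card_range B).le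
  intro b hb
  simp only [mem_image, mem_univ, true_and] at hb
  obtain ⟨i, rfl⟩ := hb
  exact mem_range.2 (mem_slots.1 (List.get_mem _ _)).2.2.2

lemma replicate_prefix_hardList {d : ℕ} (τ : ℕ → Fin d → Prop) (B K : ℕ) :
    List.replicate B (classItem 1) <+: hardList τ B (K + 1) := by
  induction K with
  | zero =>
    rw [hardList_succ, code_one, one_mul]
    simp [hardList, slots]
  | succ K ih =>
    rw [hardList_succ]
    exact ih.trans (List.prefix_append _ _)

/-- The layout gives the upper bound. For the lower bound, the list starts with `B` items of side
above `1 / 2`, no two of which share a bin. -/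
lemma opt_hardList {d : ℕ} (τ : ℕ → Fin d → Prop) (B : ℕ) {K : ℕ} (hK : 0 < K) :
    opt d (hardList τ B K) = B := by
  obtain ⟨P, hP, hPB⟩ := exists_isPacking_hardList τ B K
  refine le_antisymm (hP.opt_le.trans hPB) (le_csInf ⟨_, P, hP, rfl⟩ ?_)
  rintro _ ⟨Q, hQ, rfl⟩
  obtain ⟨K, rfl⟩ := Nat.exists_eq_succ_of_ne_zero hK.ne'
  have hpre := replicate_prefix_hardList τ B K
  have hlen : B ≤ (hardList τ B (K + 1)).length := by simpa using hpre.length_le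
  have h := hQ.card_le_mul_card_image (m := 1) (univ.filter fun i => i.val < B) (by
    rintro ⟨i, hi⟩ h
    have h' : i < B := by simpa using h
    have hget := hpre.getElem (i := i) (by simpa using h')
    rw [List.getElem_replicate] at hget
    rw [List.get_eq_getElem, ← hget, coe_classItem one_pos]
    exact one_div_lt_side 1)
  rw [Fin.card_filter_val_lt, min_eq_right hlen, one_pow, one_mul] at h
  exact h.trans (card_le_card (image_subset_image (filter_subset _ _)))

/-- The total weight of the items in one bin, an item of class `m` having weight `1 / m ^ d`. -/
noncomputable def codeWeight {d : ℕ} (τ : ℕ → Fin d → Prop) (K : ℕ) : ℝ :=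
  ∑ m ∈ range K, ((code τ (m + 1)).card : ℝ) / ((m : ℝ) + 1) ^ d

lemma OnlineBoundedSpaceAlgorithm.cost_hardList_ge {d : ℕ} (A : OnlineBoundedSpaceAlgorithm d)
    (τ : ℕ → Fin d → Prop) (B K : ℕ) :
    B * codeWeight τ K - K * A.maxOpen ≤ A.cost (hardList τ B K) := by
  induction K with
  | zero => simp [codeWeight]
  | succ K ih =>
    have h := A.cost_append_ge K.succ_pos (hardList τ B K)
      (List.replicate ((code τ (K + 1)).card * B) (classItem (K + 1))) (by
        intro x hx
        rw [(List.mem_replicate.1 hx).2, coe_classItem K.succ_pos]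
        exact one_div_lt_side _)
    rw [hardList_succ]
    refine le_trans ?_ h
    rw [codeWeight, sum_range_succ, ← codeWeight, List.length_replicate]
    push_cast
    have : ((code τ (K + 1)).card : ℝ) * B / ((K : ℝ) + 1) ^ d =
      B * ((code τ (K + 1)).card / ((K : ℝ) + 1) ^ d) := by ring
    rw [this]
    linarith

/-- A layout of total weight `W` in one bin bounds the asymptotic ratio of every algorithm
from below by `W`. -/
lemma OnlineBoundedSpaceAlgorithm.codeWeight_le_asymptoticRatio {d : ℕ}
    (A : OnlineBoundedSpaceAlgorithm d) (τ : ℕ → Fin d → Prop) {K : ℕ} (hK : 0 < K) :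
    ENNReal.ofReal (codeWeight τ K) ≤ A.asymptoticRatio := by
  have hlim : Tendsto (fun n : ℕ => ENNReal.ofReal (codeWeight τ K - K * A.maxOpen / n)) atTop
      (𝓝 (ENNReal.ofReal (codeWeight τ K))) := by
    refine ENNReal.tendsto_ofReal ?_
    simpa using (tendsto_const_nhds (x := codeWeight τ K)).sub
      (tendsto_const_div_atTop_nhds_zero_nat ((K : ℝ) * A.maxOpen))
  rw [← hlim.limsup_eq]
  refine limsup_le_limsup ?_
  filter_upwards [eventually_gt_atTop 0] with n hn
  have hopt : opt d (hardList τ n K) = n := opt_hardList τ n hK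
  refine le_trans ?_ (le_iSup₂ (f := fun (L : List Item) (_ : opt d L = n) =>
    (A.cost L : ENNReal) / (opt d L : ENNReal)) (hardList τ n K) hopt)
  have hn' : (0 : ℝ) < n := by exact_mod_cast hn
  rw [hopt, ← ENNReal.ofReal_natCast n, ← ENNReal.ofReal_natCast, ← ENNReal.ofReal_div_of_pos hn']
  refine ENNReal.ofReal_le_ofReal ?_
  rw [le_div_iff₀ hn', sub_mul, div_mul_cancel₀ _ hn'.ne', mul_comm _ (n : ℝ)]
  exact A.cost_hardList_ge τ n K

/-! ### Marks with large differences -/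

/-- The nontrivial additive character of `ZMod 2`. -/
def bitSign (x : ZMod 2) : ℤ := if x = 0 then 1 else -1

/-- Translation by a basis vector on which the form equals `1` flips every sign. -/
lemma sum_bitSign_dotProduct {r : ℕ} {u : Fin r → ZMod 2} (hu : u ≠ 0) :
    ∑ v, bitSign (u ⬝ᵥ v) = 0 := by
  obtain ⟨i, hi⟩ := Function.ne_iff.1 hu
  have hi1 : u i = 1 := by
    have : ∀ x : ZMod 2, x ≠ 0 → x = 1 := by decide
    exact this _ hi
  have hflip : ∀ x : ZMod 2, bitSign (x + 1) = -bitSign x := by decide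
  have h := Equiv.sum_comp (Equiv.addRight (Pi.single i (1 : ZMod 2))) fun v => bitSign (u ⬝ᵥ v)
  simp only [Equiv.coe_addRight, dotProduct_add, dotProduct_single, hi1, mul_one, hflip,
    sum_neg_distrib] at h
  linarith

/-- Two different nonzero linear forms on `𝔽₂ ^ r` take the values `0` and `1` simultaneously on a
quarter of the space. -/
lemma four_mul_card_dotProduct {r : ℕ} {a b : Fin r → ZMod 2} (ha : a ≠ 0) (hb : b ≠ 0)
    (hab : a ≠ b) :
    4 * (univ.filter fun v : Fin r → ZMod 2 => a ⬝ᵥ v = 0 ∧ b ⬝ᵥ v = 1).card = 2 ^ r := by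
  -- The product `(1 + χ x) * (1 - χ y)`, expanded; the three nontrivial characters sum to zero over
  -- the space.
  have hind : ∀ x y : ZMod 2, (4 * if x = 0 ∧ y = 1 then 1 else 0 : ℤ) =
      1 + bitSign x - bitSign y - bitSign (x + y) := by decide
  have hne : a + b ≠ 0 := fun h => hab (by
    rw [add_eq_zero_iff_eq_neg] at h
    rw [h]
    ext j
    simp [ZMod.neg_eq_self_mod_two])
  have h : (4 * (univ.filter fun v : Fin r → ZMod 2 => a ⬝ᵥ v = 0 ∧ b ⬝ᵥ v = 1).card : ℤ) =
      2 ^ r := by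
    rw [card_filter]
    push_cast
    rw [mul_sum]
    simp only [hind, ← add_dotProduct, sum_sub_distrib, sum_add_distrib]
    rw [sum_bitSign_dotProduct ha, sum_bitSign_dotProduct hb, sum_bitSign_dotProduct hne]
    simp
  exact_mod_cast h

/-- With `r = Nat.log 2 d`, coordinates contain a copy of `𝔽₂ ^ r` and each class is a distinct
nonzero linear form, marking where it equals `1`. A quarter of `2 ^ r > d / 2` exceeds `d / 8`. -/
lemma exists_marks {d K : ℕ} (hd : 0 < d) (hK : K < 2 ^ Nat.log 2 d) :
    ∃ τ : ℕ → Fin d → Prop, ∀ a b, 0 < a → a < b → b ≤ K →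
      ∃ S : Finset (Fin d), (∀ j ∈ S, ¬ τ a j ∧ τ b j) ∧ d ≤ 8 * S.card := by
  set r := Nat.log 2 d with hr
  obtain ⟨f⟩ : Nonempty (Fin (2 ^ r) ≃ (Fin r → ZMod 2)) :=
    Fintype.card_eq.1 (by simp)
  obtain ⟨e⟩ : Nonempty ((Fin r → ZMod 2) ↪ Fin d) :=
    Function.Embedding.nonempty_of_card_le (by simpa using Nat.pow_log_le_self 2 hd.ne')
  have hpos : 0 < 2 ^ r := by positivity
  -- The translation makes `g 0 = 0`, so injectivity on `0, …, K` makes the forms of positive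
  -- classes nonzero.
  let g : ℕ → Fin r → ZMod 2 := fun a => f (Fin.ofNat (2 ^ r) a) - f (Fin.ofNat (2 ^ r) 0)
  have hg : ∀ a b, a < b → b ≤ K → g a ≠ g b := by
    intro a b hab hb h
    have h' : Fin.ofNat (2 ^ r) a = Fin.ofNat (2 ^ r) b := f.injective (sub_left_injective h)
    simp only [Fin.ofNat, Fin.mk.injEq] at h'
    rw [Nat.mod_eq_of_lt (by omega), Nat.mod_eq_of_lt (by omega)] at h'
    omega
  have hg0 : g 0 = 0 := sub_self _
  refine ⟨fun a j => ∃ v, e v = j ∧ g a ⬝ᵥ v = 1, fun a b ha hab hb => ?_⟩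
  refine ⟨(univ.filter fun v => g a ⬝ᵥ v = 0 ∧ g b ⬝ᵥ v = 1).map e, ?_, ?_⟩
  · intro j hj
    simp only [Finset.mem_map, mem_filter, mem_univ, true_and] at hj
    obtain ⟨v, ⟨h0, h1⟩, rfl⟩ := hj
    refine ⟨?_, v, rfl, h1⟩
    rintro ⟨v', hv', h⟩
    rw [e.injective hv', h0] at h
    exact zero_ne_one h
  · rw [card_map]
    have h4 := four_mul_card_dotProduct (hg0 ▸ (hg 0 a ha (by omega)).symm)
      (hg0 ▸ (hg 0 b (by omega) hb).symm) (hg a b hab hb)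
    have := Nat.lt_pow_succ_log_self (b := 2) (by norm_num) d
    rw [← hr, Nat.succ_eq_add_one, pow_succ] at this
    omega

/-! ### The size of the codes -/

/-- The words of length `d` over `m` letters that omit the last letter on `S`. -/
lemma card_words_omitting {d m : ℕ} (hm : 0 < m) (S : Finset (Fin d)) :
    ((Fintype.piFinset fun j => range (if j ∈ S then m - 1 else m)).card : ℝ) / (m : ℝ) ^ d =
      (1 - 1 / (m : ℝ)) ^ S.card := by
  have hm' : (m : ℝ) ≠ 0 := by positivity
  have hprod : (m : ℝ) ^ d = ∏ _j : Fin d, (m : ℝ) := by simp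
  rw [Fintype.card_piFinset, hprod, Nat.cast_prod, ← prod_div_distrib]
  have : ∀ j, (((range (if j ∈ S then m - 1 else m)).card : ℕ) : ℝ) / m =
      if j ∈ S then 1 - 1 / (m : ℝ) else 1 := by
    intro j
    split_ifs
    · rw [card_range, Nat.cast_pred hm, sub_div, div_self hm']
    · rw [card_range, div_self hm']
  simp only [this]
  rw [prod_ite_mem, univ_inter, prod_const]

/-- Union bound over the smaller classes `a`: a word that fails for `a` omits the last letter on all
of `S a`, which has probability `(1 - 1 / m) ^ (S a).card`. -/
lemma card_code_ge {d m K : ℕ} {τ : ℕ → Fin d → Prop} (hm : 0 < m) (hmK : m ≤ K)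
    (hτ : ∀ a b, 0 < a → a < b → b ≤ K →
      ∃ S : Finset (Fin d), (∀ j ∈ S, ¬ τ a j ∧ τ b j) ∧ d ≤ 8 * S.card) :
    1 - K * Real.exp (-(d / (8 * K))) ≤ ((code τ m).card : ℝ) / (m : ℝ) ^ d := by
  have hτ' : ∀ a, ∃ S : Finset (Fin d), 0 < a → a < m →
      (∀ j ∈ S, ¬ τ a j ∧ τ m j) ∧ d ≤ 8 * S.card := by
    intro a
    by_cases h : 0 < a ∧ a < m
    · obtain ⟨S, hS⟩ := hτ a m h.1 h.2 hmK
      exact ⟨S, fun _ _ => hS⟩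
    · exact ⟨∅, fun h1 h2 => absurd ⟨h1, h2⟩ h⟩
  choose S hS using hτ'
  have hm' : (0 : ℝ) < m := by exact_mod_cast hm
  have hsub : (Fintype.piFinset fun _ : Fin d => range m) ⊆ code τ m ∪ (Ioo 0 m).biUnion fun a =>
      Fintype.piFinset fun j => range (if j ∈ S a then m - 1 else m) := by
    intro w hw
    by_contra hcon
    simp only [mem_union, mem_biUnion, mem_Ioo, not_or, not_exists, not_and] at hcon
    refine hcon.1 ?_
    simp only [code, mem_filter]
    refine ⟨hw, fun a ha ham => ?_⟩
    have := hcon.2 a ⟨ha, ham⟩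
    simp only [Fintype.mem_piFinset, mem_range, not_forall] at this hw
    obtain ⟨j, hj⟩ := this
    have hwj := hw j
    split_ifs at hj with hjS
    · exact ⟨j, ((hS a ha ham).1 j hjS).1, ((hS a ha ham).1 j hjS).2, by omega⟩
    · exact absurd hwj hj
  have hcard : ((m : ℝ) ^ d) ≤ (code τ m).card + ∑ a ∈ Ioo 0 m,
      ((Fintype.piFinset fun j => range (if j ∈ S a then m - 1 else m)).card : ℝ) := by
    have h := (card_le_card hsub).trans ((card_union_le _ _).trans
      (Nat.add_le_add_left card_biUnion_le _))
    simp only [Fintype.card_piFinset_const, card_range] at h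
    exact_mod_cast h
  have hone : 1 ≤ ((code τ m).card : ℝ) / (m : ℝ) ^ d +
      ∑ a ∈ Ioo 0 m, (1 - 1 / (m : ℝ)) ^ (S a).card := by
    have h := div_le_div_of_nonneg_right hcard (pow_pos hm' d).le
    rw [div_self (pow_pos hm' d).ne', add_div, sum_div] at h
    simpa only [card_words_omitting hm] using h
  have hterm : ∀ a ∈ Ioo 0 m, (1 - 1 / (m : ℝ)) ^ (S a).card ≤
      Real.exp (-(d / (8 * K))) := by
    intro a ha
    rw [mem_Ioo] at ha
    have hd : (d : ℝ) ≤ 8 * (S a).card := by exact_mod_cast (hS a ha.1 ha.2).2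
    have hK : (m : ℝ) ≤ K := by exact_mod_cast hmK
    have hK' : (0 : ℝ) < K := hm'.trans_le hK
    have h1m : 1 / (m : ℝ) ≤ 1 := by
      rw [div_le_one hm']
      exact_mod_cast hm
    calc (1 - 1 / (m : ℝ)) ^ (S a).card
        ≤ Real.exp (-(1 / (m : ℝ))) ^ (S a).card :=
          pow_le_pow_left₀ (by linarith) (Real.one_sub_le_exp_neg _) _
      _ = Real.exp (-((S a).card / (m : ℝ))) := by
          rw [← Real.exp_nat_mul]
          congr 1
          ring
      _ ≤ Real.exp (-(d / (8 * K))) := by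
          rw [Real.exp_le_exp, neg_le_neg_iff, div_le_div_iff₀ (by positivity) hm']
          nlinarith [mul_le_mul hd hK hm'.le (by positivity)]
  have hsum : ∑ a ∈ Ioo 0 m, (1 - 1 / (m : ℝ)) ^ (S a).card ≤
      K * Real.exp (-(d / (8 * K))) := by
    refine (sum_le_card_nsmul _ _ _ hterm).trans ?_
    rw [nsmul_eq_mul]
    gcongr
    simp
    omega
  linarith

lemma codeWeight_ge {d K : ℕ} {τ : ℕ → Fin d → Prop}
    (hτ : ∀ a b, 0 < a → a < b → b ≤ K →
      ∃ S : Finset (Fin d), (∀ j ∈ S, ¬ τ a j ∧ τ b j) ∧ d ≤ 8 * S.card) :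
    K * (1 - K * Real.exp (-(d / (8 * K)))) ≤ codeWeight τ K := by
  have h := card_nsmul_le_sum (range K)
    (fun m => ((code τ (m + 1)).card : ℝ) / ((m : ℝ) + 1) ^ d)
    (1 - K * Real.exp (-(d / (8 * K)))) fun m hm => by
      have := card_code_ge m.succ_pos (mem_range.1 hm) hτ
      exact_mod_cast this
  rwa [card_range, nsmul_eq_mul] at h

/-! ### Asymptotics -/

open Real in
lemma exists_number_of_classes : ∀ᶠ d : ℕ in atTop, ∃ K : ℕ, 0 < K ∧ K < 2 ^ Nat.log 2 d ∧
    (d : ℝ) / (10 * log d) ≤ K * (1 - K * exp (-(d / (8 * K)))) := by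
  have hcast := tendsto_natCast_atTop_atTop (R := ℝ)
  have hlog : Tendsto (fun d : ℕ => log d) atTop atTop := tendsto_log_atTop.comp hcast
  have hpow : Tendsto (fun d : ℕ => (d : ℝ) ^ (-(1 / 8) : ℝ)) atTop (𝓝 0) :=
    (tendsto_rpow_neg_atTop (by norm_num)).comp hcast
  have hlittle : ∀ᶠ d : ℕ in atTop, log d ≤ 1 / 200 * d := by
    have h := (isLittleO_log_id_atTop.comp_tendsto hcast).bound (c := 1 / 200) (by norm_num)
    filter_upwards [h] with d hd
    simp only [Function.comp, id, norm_eq_abs, Nat.abs_cast] at hd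
    exact (le_abs_self _).trans hd
  filter_upwards [hlog.eventually_ge_atTop 1, hpow.eventually_le_const (u := 1 / 200) (by norm_num),
    hlittle, eventually_gt_atTop 0] with d h1 h8 hl hd
  have hd' : (0 : ℝ) < d := by exact_mod_cast hd
  -- With `9 > 8`, `K = ⌊x⌋₊` has `K * exp (-(d / (8 * K))) ≤ d * d ^ (-9 / 8)`, which tends to `0`;
  -- with `9 < 10`, room remains for the rounding and this loss.
  set x : ℝ := d / (9 * log d) with hx
  have hx20 : 20 ≤ x := by
    rw [hx, le_div_iff₀ (by positivity)]
    linarith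
  have hKx : (⌊x⌋₊ : ℝ) ≤ x := Nat.floor_le (by linarith)
  have hxK : x < ⌊x⌋₊ + 1 := Nat.lt_floor_add_one x
  have hK0 : (0 : ℝ) < ⌊x⌋₊ := by linarith
  have hxd : x ≤ d / 9 := by
    rw [hx]
    gcongr
    linarith
  refine ⟨⌊x⌋₊, by exact_mod_cast hK0, ?_, ?_⟩
  · have h := Nat.lt_pow_succ_log_self (b := 2) (by norm_num) d
    rw [Nat.succ_eq_add_one, pow_succ] at h
    have h' : (9 * ⌊x⌋₊ : ℝ) ≤ d := by linarith
    have h'' : 9 * ⌊x⌋₊ ≤ d := by exact_mod_cast h'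
    omega
  · have hexp : exp (-(d / (8 * ⌊x⌋₊))) ≤ (d : ℝ) ^ (-(1 / 8) : ℝ) / d := by
      rw [← rpow_sub_one hd'.ne', rpow_def_of_pos hd', exp_le_exp]
      have h9 : 9 / 8 * log d = d / (8 * x) := by
        rw [hx]
        field_simp
      have : (d : ℝ) / (8 * x) ≤ d / (8 * ⌊x⌋₊) := by gcongr
      linarith
    have hKe : ⌊x⌋₊ * exp (-(d / (8 * ⌊x⌋₊))) ≤ 1 / 200 := by
      calc ⌊x⌋₊ * exp (-(d / (8 * ⌊x⌋₊))) ≤ d * ((d : ℝ) ^ (-(1 / 8) : ℝ) / d) :=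
            mul_le_mul (by linarith) hexp (exp_pos _).le hd'.le
        _ ≤ 1 / 200 := by rwa [mul_div_cancel₀ _ hd'.ne']
    have hgoal : (d : ℝ) / (10 * log d) = 9 / 10 * x := by
      rw [hx]
      field_simp
    rw [hgoal]
    nlinarith

lemma eventually_le_asymptoticRatio : ∀ᶠ d : ℕ in atTop,
    ∀ A : OnlineBoundedSpaceAlgorithm d,
      ENNReal.ofReal ((d : ℝ) / (10 * Real.log d)) ≤ A.asymptoticRatio := by
  filter_upwards [exists_number_of_classes, eventually_gt_atTop 0] with d ⟨K, hK, hKd, hdK⟩ hd A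
  obtain ⟨τ, hτ⟩ := exists_marks hd hKd
  exact (ENNReal.ofReal_le_ofReal (hdK.trans (codeWeight_ge hτ))).trans
    (A.codeWeight_le_asymptoticRatio τ hK)

open Real in
lemma eventually_mul_log_lt (C : ℝ) :
    ∀ᶠ d : ℕ in atTop, C * log d < (d : ℝ) / (10 * log d) := by
  have hcast := tendsto_natCast_atTop_atTop (R := ℝ)
  have hlog : Tendsto (fun d : ℕ => log d) atTop atTop := tendsto_log_atTop.comp hcast
  have h := ((isLittleO_pow_log_id_atTop (n := 2)).comp_tendsto hcast).bound
    (c := 1 / (20 * (|C| + 1))) (by positivity)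
  filter_upwards [h, hlog.eventually_gt_atTop 0, eventually_gt_atTop 0] with d hd hl hd0
  have hd' : (0 : ℝ) < d := by exact_mod_cast hd0
  simp only [Function.comp, id, norm_eq_abs, Nat.abs_cast, abs_pow, sq_abs] at hd
  rw [div_mul_eq_mul_div, one_mul, le_div_iff₀ (by positivity)] at hd
  rw [lt_div_iff₀ (by positivity)]
  nlinarith [le_abs_self C, mul_pos hl hl]

end HypercubePacking

theorem theorem1 :
    (∃ d₀ : ℕ, ∀ d : ℕ, d₀ ≤ d →
      (∀ A : HypercubePacking.OnlineBoundedSpaceAlgorithm d,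
        ENNReal.ofReal ((d : ℝ) / (10 * Real.log (d : ℝ))) ≤ A.asymptoticRatio) ∧
      ENNReal.ofReal ((d : ℝ) / (10 * Real.log (d : ℝ))) ≤
        HypercubePacking.optimalAsymptoticRatio d) ∧
    ¬ ∃ C : ℝ, ∀ᶠ d : ℕ in Filter.atTop,
      HypercubePacking.optimalAsymptoticRatio d ≤ ENNReal.ofReal (C * Real.log (d : ℝ)) := by
  have h := HypercubePacking.eventually_le_asymptoticRatio
  refine ⟨?_, ?_⟩
  · obtain ⟨d₀, h⟩ := Filter.eventually_atTop.1 h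
    exact ⟨d₀, fun d hd => ⟨h d hd, le_iInf (h d hd)⟩⟩
  · rintro ⟨C, hC⟩
    obtain ⟨d, hd, hdC, hlt, hd1⟩ := (h.and (hC.and
      ((HypercubePacking.eventually_mul_log_lt C).and (Filter.eventually_gt_atTop 1)))).exists
    have hpos : 0 < (d : ℝ) / (10 * Real.log d) :=
      div_pos (by positivity) (mul_pos (by norm_num) (Real.log_pos (by exact_mod_cast hd1)))
    exact absurd ((le_iInf hd).trans hdC)
      (not_le.2 ((ENNReal.ofReal_lt_ofReal_iff hpos).2 hlt))
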